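/- Let $K\in C([0,\infty)\times[0,\infty))$ be nonnegative, symmetric ($K(x,y)=K(y,x)$) and homogeneous of degree one ($K(ax,ay)=aK(x,y)$ for all $a,x,y>0$). Assume that $$\lim_{\xi\to0^+}\frac{K(1,\xi)-1}{\xi^\alpha}=\beta_0\quad\text{for some }\beta_0>0,\ \alpha\in(0,1),$$ and that $K(1,\xi)\ge k_0$ for all $\xi\ge0$, for some $k_0>0$. For $b>0$, a positive Radon measure $g$ on $[0,\infty)$ is called a weak solution of the self-similar equation $$b\,x\,g(x)=\int_0^x\int_{x-y}^\infty \frac{K(y,z)}{z}\,g(y)g(z)\,dz\,dy$$ if for every $\theta\in C([0,\infty))$ with compact support $$b\int_{[0,\infty)}x\,\theta(x)\,g(dx)=\int_{[0,\infty)}\int_{[0,\infty)}\Bigl(\frac{K(y,z)}{z}\int_y^{y+z}\theta(x)\,dx\Bigr)\,g(dz)\,g(dy),$$ where the double integral converges absolutely (which is automatic if $g$ has finite mass) and the integrand in parentheses is understood at $z=0$ as its limit $K(y,0)\theta(y)$. Then there is $b_*>1$ such that for every $b\in(1,b_*)$ the unique weak solution $g$ with unit mass, $g([0,\infty))=1$,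 among the positive Radon measures on $[0,\infty)$ is the Dirac measure $\delta_0$. Equivalently, there is $\rho_*>0$ such that for every $\rho>\rho_*$ and $b=\frac{1+\rho}{\rho}$ there is no weak solution of unit mass other than $\delta_0$. -/

import Mathlib

open MeasureTheory Set Filter Topology

/-- `g` is a positive Radon measure on `[0,∞)`, seen as a Borel measure on `ℝ` that does not charge
`(-∞,0)`. (On `ℝ`, a locally finite Borel measure is automatically regular.) -/
structure IsRadonOnHalfLine (g : Measure ℝ) : Prop where
  locallyFinite : IsLocallyFiniteMeasure g
  null_neg : g (Iio 0) = 0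

/-- `θ` is (on `[0,∞)`) a continuous function with compact support in `[0,∞)`.
The values of `θ` on the negative half-line play no role. -/
structure IsTestFun (θ : ℝ → ℝ) : Prop where
  continuousOn : ContinuousOn θ (Ici 0)
  compactSupport : ∃ R : ℝ, ∀ x : ℝ, R < x → θ x = 0

/-- The function `(K(y,z) / z) ∫_y^{y+z} θ(x) dx` of `(y,z) ∈ [0,∞)²`, which is understood
at `z = 0` as its limit `K(y,0) θ(y)`. -/
noncomputable def coagIntegrand (K : ℝ → ℝ → ℝ) (θ : ℝ → ℝ) (y z : ℝ) : ℝ :=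
  if z = 0 then K y 0 * θ y else K y z / z * ∫ x in y..(y + z), θ x

/-- The measure `g` on `[0,∞)` is a weak solution of the self-similar equation
`b x g(x) = ∫_0^x ∫_{x-y}^∞ (K(y,z)/z) g(y) g(z) dz dy`: for every test function `θ`,
`b ∫ x θ(x) g(dx) = ∫∫ (K(y,z)/z) (∫_y^{y+z} θ(x) dx) g(dy) g(dz)`.
The double integral is required to converge absolutely; for kernels that are continuous and
homogeneous of degree one this is automatic when `g` is finite, the integrand being bounded. -/
def IsWeakSolution (K : ℝ → ℝ → ℝ) (b : ℝ) (g : Measure ℝ) : Prop :=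
  ∀ θ : ℝ → ℝ, IsTestFun θ →
    IntegrableOn (fun p : ℝ × ℝ => coagIntegrand K θ p.1 p.2) (Ici 0 ×ˢ Ici 0) (g.prod g) ∧
    b * ∫ x in Ici (0 : ℝ), x * θ x ∂g =
      ∫ y in Ici (0 : ℝ), ∫ z in Ici (0 : ℝ), coagIntegrand K θ y z ∂g ∂g

/-! Suppose `g ≠ δ₀`. Testing with `1/x` on `(s, ∞)` bounds `k₀ log (r/s) g([0,s]) g((r,∞))` by `b`
(`IsWeakSolution.log_mul_measure_le`). Letting `s → 0` shows that `g` has no atom at `0`. If `m` is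
a median up to a factor `2`, the mass beyond `2mΛ` is small, with `Λ` depending only on `k₀`.

Next, `θ = h` on `(R, ∞)` is tested and only interactions of a size at most `εR` with a large one
are kept (`IsWeakSolution.rectangles_le`). A large `y` meeting a small `z` already returns nearly
the whole left side, since `K(y,z) ≥ y`. The opposite order, small `y` and `z > 2R`, contributes a
further half of the part beyond `2R`. With `h` a truncation this surplus bounds the first moment
(`IsWeakSolution.first_moment_le`), so at `R = 2mN` the mass `T` beyond `εR` is `O(1/N)`.

Finally take `h = 1`. Sizes in `(m, εR]` carry mass at least `7/16`, and the term `ξ^α` in `K(1,ξ)`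
gives a relative gain `κ ~ N^(-α)` on `(R, 2R]`. As `α < 1`, a large fixed `N` makes `κ` dominate
`T`; if `b - 1` is also small against `κ`, then `g((R,∞)) = 0`. This contradicts the unboundedness
of the support (`IsWeakSolution.measure_Ioi_ne_zero`). Neither `N` nor `κ` depends on `g`. -/

/-- Homogeneity of degree one, extended to the boundary by continuity. -/
theorem kernel_eq_mul_kernel_one {K : ℝ → ℝ → ℝ}
    (hK_cont : ContinuousOn (fun p : ℝ × ℝ => K p.1 p.2) (Ici 0 ×ˢ Ici 0))
    (hK_symm : ∀ x y : ℝ, 0 ≤ x → 0 ≤ y → K x y = K y x)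
    (hK_hom : ∀ a x y : ℝ, 0 < a → 0 < x → 0 < y → K (a * x) (a * y) = a * K x y)
    {y z : ℝ} (hy : 0 ≤ y) (hz : 0 < z) : K y z = z * K 1 (y / z) := by
  have h1 : ContinuousOn (fun y : ℝ => K y z) (Ici 0) :=
    hK_cont.comp (f := fun y : ℝ => (y, z)) (by fun_prop)
      (fun t ht => ⟨ht, hz.le⟩)
  have h2 : ContinuousOn (fun y : ℝ => z * K 1 (y / z)) (Ici 0) := by
    refine continuousOn_const.mul ?_
    exact hK_cont.comp (f := fun y : ℝ => ((1 : ℝ), y / z)) (by fun_prop)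
      (fun t ht => ⟨mem_Ici.2 zero_le_one, div_nonneg ht hz.le⟩)
  have h3 : EqOn (fun y : ℝ => K y z) (fun y : ℝ => z * K 1 (y / z)) (Ioi 0) := by
    intro t ht
    have ht' : 0 < t := ht
    have := hK_hom z 1 (t / z) hz one_pos (div_pos ht' hz)
    rw [mul_one, mul_div_cancel₀ _ hz.ne'] at this
    simp only
    rw [hK_symm t z ht'.le hz.le, this]
  exact h3.of_subset_closure h1 h2 Ioi_subset_Ici_self (by rw [closure_Ioi]) hy

theorem exists_one_add_rpow_le {f : ℝ → ℝ} {α β : ℝ} (hβ : 0 < β)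
    (hf : Tendsto (fun ξ : ℝ => (f ξ - 1) / ξ ^ α) (𝓝[>] 0) (𝓝 β)) :
    ∃ ε : ℝ, 0 < ε ∧ ε ≤ 1 / 16 ∧ ∀ ξ : ℝ, 0 < ξ → ξ ≤ ε → 1 + β / 2 * ξ ^ α ≤ f ξ := by
  have h1 : ∀ᶠ ξ in 𝓝[>] (0 : ℝ), β / 2 < (f ξ - 1) / ξ ^ α :=
    hf.eventually (lt_mem_nhds (by linarith))
  obtain ⟨δ, hδ, h2⟩ := mem_nhdsGT_iff_exists_Ioc_subset.1 h1
  refine ⟨min δ (1 / 16), lt_min hδ (by norm_num), min_le_right _ _, fun ξ h0 h => ?_⟩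
  have h3 : β / 2 < (f ξ - 1) / ξ ^ α := h2 ⟨h0, h.trans (min_le_left _ _)⟩
  rw [lt_div_iff₀ (Real.rpow_pos_of_pos h0 α)] at h3
  linarith

/-! ### Cutoffs and passage to unbounded test functions -/

/-- Continuous compactly supported approximations of the indicator function of `(R, ∞)`. -/
noncomputable def cutoff (R : ℝ) (n : ℕ) (x : ℝ) : ℝ :=
  max 0 (min 1 (min (n * (x - R)) (n - x)))

theorem continuous_cutoff (R : ℝ) (n : ℕ) : Continuous (cutoff R n) := by
  unfold cutoff; fun_prop

theorem cutoff_nonneg (R : ℝ) (n : ℕ) (x : ℝ) : 0 ≤ cutoff R n x := le_max_left _ _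

theorem cutoff_le_one (R : ℝ) (n : ℕ) (x : ℝ) : cutoff R n x ≤ 1 :=
  max_le zero_le_one (min_le_left _ _)

theorem cutoff_eq_zero_of_le {R : ℝ} {n : ℕ} {x : ℝ} (hx : x ≤ R) : cutoff R n x = 0 := by
  refine max_eq_left (((min_le_right _ _).trans (min_le_left _ _)).trans ?_)
  exact mul_nonpos_of_nonneg_of_nonpos n.cast_nonneg (by linarith)

theorem cutoff_eq_zero_of_ge {R : ℝ} {n : ℕ} {x : ℝ} (hx : (n : ℝ) ≤ x) : cutoff R n x = 0 := by
  refine max_eq_left (((min_le_right _ _).trans (min_le_right _ _)).trans ?_)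
  linarith

theorem tendsto_cutoff (R x : ℝ) (h : ℝ → ℝ) :
    Tendsto (fun n : ℕ => cutoff R n x * h x) atTop (𝓝 ((Ioi R).indicator h x)) := by
  rcases le_or_gt x R with hx | hx
  · rw [indicator_of_notMem (by simpa using hx)]
    simp [cutoff_eq_zero_of_le hx]
  · rw [indicator_of_mem (by simpa using hx)]
    have h1 : ∀ᶠ n : ℕ in atTop, 1 / (x - R) ≤ n :=
      tendsto_natCast_atTop_atTop.eventually_ge_atTop _
    have h2 : ∀ᶠ n : ℕ in atTop, x + 1 ≤ n :=
      tendsto_natCast_atTop_atTop.eventually_ge_atTop _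
    refine tendsto_const_nhds.congr' ?_
    filter_upwards [h1, h2] with n hn1 hn2
    rw [div_le_iff₀ (by linarith)] at hn1
    have : cutoff R n x = 1 := by
      unfold cutoff
      rw [min_eq_left (le_min hn1 (by linarith)), max_eq_right zero_le_one]
    rw [this, one_mul]

theorem isTestFun_cutoff_mul {h : ℝ → ℝ} (hc : Continuous h) (R : ℝ) (n : ℕ) :
    IsTestFun (fun x => cutoff R n x * h x) where
  continuousOn := ((continuous_cutoff R n).mul hc).continuousOn
  compactSupport := ⟨n, fun x hx => by simp [cutoff_eq_zero_of_ge hx.le]⟩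

theorem tendsto_intervalIntegral_cutoff {h : ℝ → ℝ} (hc : Continuous h) (R a c : ℝ) :
    Tendsto (fun n : ℕ => ∫ x in a..c, cutoff R n x * h x) atTop
      (𝓝 (∫ x in a..c, (Ioi R).indicator h x)) := by
  refine intervalIntegral.tendsto_integral_filter_of_dominated_convergence (fun x => |h x|)
    (Eventually.of_forall fun n =>
      ((continuous_cutoff R n).mul hc).aestronglyMeasurable)
    (Eventually.of_forall fun n => Eventually.of_forall fun x _ => ?_)
    (hc.abs.intervalIntegrable _ _) (Eventually.of_forall fun x _ => tendsto_cutoff R x h)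
  rw [Real.norm_eq_abs, abs_mul, abs_of_nonneg (cutoff_nonneg R n x)]
  exact mul_le_of_le_one_left (abs_nonneg _) (cutoff_le_one R n x)

/-- Testing the equation with `h` restricted to `(R, ∞)`, as an inequality between Lebesgue
integrals. -/
theorem IsWeakSolution.lintegral_le {K : ℝ → ℝ → ℝ} {b : ℝ} {g : Measure ℝ} [IsFiniteMeasure g]
    (hg : IsWeakSolution K b g) (hK_nonneg : ∀ x y : ℝ, 0 ≤ x → 0 ≤ y → 0 ≤ K x y)
    (hb : 0 ≤ b) {h : ℝ → ℝ} (hc : Continuous h) (h0 : ∀ x, 0 ≤ h x) {R : ℝ} (hR : 0 ≤ R) :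
    ∫⁻ p in Ici 0 ×ˢ Ioi 0,
        ENNReal.ofReal (K p.1 p.2 / p.2 * ∫ x in p.1..(p.1 + p.2), (Ioi R).indicator h x)
          ∂(g.prod g) ≤
      ENNReal.ofReal b * ∫⁻ x in Ioi R, ENNReal.ofReal (x * h x) ∂g := by
  set θ : ℕ → ℝ → ℝ := fun n x => cutoff R n x * h x with hθ
  have hθ0 : ∀ n x, 0 ≤ θ n x := fun n x => mul_nonneg (cutoff_nonneg R n x) (h0 x)
  have hF0 : ∀ n, ∀ p ∈ (Ici 0 ×ˢ Ici 0 : Set (ℝ × ℝ)), 0 ≤ coagIntegrand K (θ n) p.1 p.2 := by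
    rintro n ⟨y, z⟩ ⟨hy, hz⟩
    simp only [mem_Ici] at hy hz
    unfold coagIntegrand
    split_ifs
    · exact mul_nonneg (hK_nonneg _ _ hy le_rfl) (hθ0 _ _)
    · exact mul_nonneg (div_nonneg (hK_nonneg _ _ hy hz) hz)
        (intervalIntegral.integral_nonneg (by simpa using hz) fun x _ => hθ0 n x)
  have hquad : MeasurableSet (Ici 0 ×ˢ Ici 0 : Set (ℝ × ℝ)) :=
    measurableSet_Ici.prod measurableSet_Ici
  have hbound : ∀ n, ∫⁻ p in Ici 0 ×ˢ Ici 0,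
      ENNReal.ofReal (coagIntegrand K (θ n) p.1 p.2) ∂(g.prod g) ≤
        ENNReal.ofReal b * ∫⁻ x in Ioi R, ENNReal.ofReal (x * h x) ∂g := by
    intro n
    obtain ⟨hint, heq⟩ := hg (θ n) (isTestFun_cutoff_mul hc R n)
    rw [← ofReal_integral_eq_lintegral_ofReal hint
      ((ae_restrict_iff' hquad).2 (Eventually.of_forall (hF0 n)))]
    have hprod : ∫ p in Ici 0 ×ˢ Ici 0, coagIntegrand K (θ n) p.1 p.2 ∂(g.prod g) =
        ∫ y in Ici (0 : ℝ), ∫ z in Ici (0 : ℝ), coagIntegrand K (θ n) y z ∂g ∂g :=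
      setIntegral_prod _ hint
    rw [hprod, ← heq, ENNReal.ofReal_mul hb]
    gcongr
    -- Without integrability the Bochner integral is `0` by convention, and the bound is trivial.
    by_cases hi : Integrable (fun x => x * θ n x) (g.restrict (Ici 0))
    · rw [ofReal_integral_eq_lintegral_ofReal hi ((ae_restrict_iff' measurableSet_Ici).2
        (Eventually.of_forall fun x hx => mul_nonneg hx (hθ0 n x)))]
      rw [← lintegral_indicator measurableSet_Ici, ← lintegral_indicator measurableSet_Ioi]
      refine lintegral_mono fun x => ?_
      by_cases hx : x ∈ Ioi R
      · have hx0 : (0 : ℝ) ≤ x := hR.trans (le_of_lt hx)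
        rw [indicator_of_mem hx, indicator_of_mem (show x ∈ Ici (0 : ℝ) from hx0)]
        refine ENNReal.ofReal_le_ofReal (mul_le_mul_of_nonneg_left ?_ hx0)
        exact mul_le_of_le_one_left (h0 x) (cutoff_le_one R n x)
      · have : θ n x = 0 := by simp [hθ, cutoff_eq_zero_of_le (not_lt.1 hx)]
        simp [indicator, this]
    · rw [integral_undef hi]; simp
  -- The integrand is nonnegative and only a lower bound is wanted, so the line `z = 0` can be
  -- dropped.
  have hsub : (Ici 0 ×ˢ Ioi 0 : Set (ℝ × ℝ)) ⊆ Ici 0 ×ˢ Ici 0 :=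
    prod_mono_right Ioi_subset_Ici_self
  calc _ = ∫⁻ p in Ici 0 ×ˢ Ioi 0, liminf (fun n =>
        ENNReal.ofReal (coagIntegrand K (θ n) p.1 p.2)) atTop ∂(g.prod g) := by
        refine setLIntegral_congr_fun (measurableSet_Ici.prod measurableSet_Ioi) ?_
        rintro ⟨y, z⟩ ⟨hy, hz⟩
        simp only [mem_Ici, mem_Ioi] at hy hz
        refine (Tendsto.liminf_eq ?_).symm
        refine (ENNReal.continuous_ofReal.tendsto _).comp ?_
        simp only [coagIntegrand, if_neg hz.ne']
        exact (tendsto_intervalIntegral_cutoff hc R y (y + z)).const_mul _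
    _ ≤ liminf (fun n => ∫⁻ p in Ici 0 ×ˢ Ioi 0,
          ENNReal.ofReal (coagIntegrand K (θ n) p.1 p.2) ∂(g.prod g)) atTop :=
        lintegral_liminf_le' fun n =>
          ((hg (θ n) (isTestFun_cutoff_mul hc R n)).1.mono_set hsub).aemeasurable.ennreal_ofReal
    _ ≤ _ := liminf_le_of_frequently_le' (Frequently.of_forall fun n =>
        (lintegral_mono_set hsub).trans (hbound n))

/-! ### Elementary integral bounds -/

theorem intervalIntegral_le_indicator {h : ℝ → ℝ} (hc : Continuous h) (h0 : ∀ x, 0 ≤ h x)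
    {R y z s r : ℝ} (hy : y ≤ s) (hR : R ≤ s) (hsr : s ≤ r) (hr : r ≤ y + z) :
    ∫ x in s..r, h x ≤ ∫ x in y..(y + z), (Ioi R).indicator h x := by
  have hi : ∀ a c : ℝ, IntervalIntegrable ((Ioi R).indicator h) volume a c := fun a c =>
    ⟨(hc.intervalIntegrable a c).1.indicator measurableSet_Ioi,
      (hc.intervalIntegrable a c).2.indicator measurableSet_Ioi⟩
  calc ∫ x in s..r, h x = ∫ x in s..r, (Ioi R).indicator h x := by
        refine intervalIntegral.integral_congr_ae (Eventually.of_forall fun x hx => ?_)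
        rw [uIoc_of_le hsr] at hx
        rw [indicator_of_mem (show x ∈ Ioi R from hR.trans_lt hx.1)]
    _ ≤ _ := intervalIntegral.integral_mono_interval hy hsr hr
        (Eventually.of_forall fun x => indicator_nonneg (fun x _ => h0 x) x) (hi _ _)

theorem mul_le_intervalIntegral_of_antitoneOn {h : ℝ → ℝ} (hc : Continuous h)
    (ha : AntitoneOn h (Ioi 0)) {s r : ℝ} (hs : 0 < s) (hsr : s ≤ r) :
    (r - s) * h r ≤ ∫ x in s..r, h x := by
  have := intervalIntegral.integral_mono_on hsr (f := fun _ => h r) (μ := volume)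
    (by simp) (hc.intervalIntegrable s r)
    (fun x hx => ha (hs.trans_le hx.1) (hs.trans_le hsr) hx.2)
  simpa using this

theorem setLIntegral_prod_fst {g : Measure ℝ} [IsFiniteMeasure g] {f : ℝ → ENNReal}
    (hf : Measurable f) (A B : Set ℝ) :
    ∫⁻ p in A ×ˢ B, f p.1 ∂(g.prod g) = (∫⁻ y in A, f y ∂g) * g B := by
  have := lintegral_prod_mul (μ := g.restrict A) (ν := g.restrict B) (f := f)
    (g := fun _ => 1) hf.aemeasurable aemeasurable_const
  simpa [Measure.prod_restrict] using this

theorem setLIntegral_prod_snd {g : Measure ℝ} [IsFiniteMeasure g] {f : ℝ → ENNReal}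
    (hf : Measurable f) (A B : Set ℝ) :
    ∫⁻ p in A ×ˢ B, f p.2 ∂(g.prod g) = g A * ∫⁻ z in B, f z ∂g := by
  have := lintegral_prod_mul (μ := g.restrict A) (ν := g.restrict B) (f := fun _ => 1)
    (g := f) aemeasurable_const hf.aemeasurable
  simpa [Measure.prod_restrict] using this

/-! ### Logarithmic estimate and unbounded support -/

section Solution

variable {K : ℝ → ℝ → ℝ} {b k₀ : ℝ} {g : Measure ℝ} [IsFiniteMeasure g]

/-- The weight `1/x` on `(s, ∞)` turns the left side into mass. For `y ≤ s` and `z > r` the interval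
`(y, y + z)` contains `(s, r)`, where `1/x` integrates to `log (r/s)`, and `K y z / z ≥ k₀`. The
maximum with `s` only keeps the weight continuous. -/
theorem IsWeakSolution.log_mul_measure_le (hg : IsWeakSolution K b g)
    (hK_nonneg : ∀ x y : ℝ, 0 ≤ x → 0 ≤ y → 0 ≤ K x y)
    (hK : ∀ y z : ℝ, 0 ≤ y → 0 < z → K y z = z * K 1 (y / z))
    (hK_pos : ∀ ξ : ℝ, 0 ≤ ξ → k₀ ≤ K 1 ξ) (hk₀ : 0 < k₀) (hb : 0 ≤ b)
    {s r : ℝ} (hs : 0 < s) (hsr : s ≤ r) :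
    ENNReal.ofReal (k₀ * Real.log (r / s)) * (g (Icc 0 s) * g (Ioi r)) ≤
      ENNReal.ofReal b * g univ := by
  have hc : Continuous fun x : ℝ => (max x s)⁻¹ :=
    (continuous_id.max continuous_const).inv₀ fun x => (hs.trans_le (le_max_right _ _)).ne'
  have h0 : ∀ x : ℝ, 0 ≤ (max x s)⁻¹ := fun x => inv_nonneg.2 (hs.le.trans (le_max_right _ _))
  have hkey := hg.lintegral_le hK_nonneg hb hc h0 hs.le
  have hlow : ENNReal.ofReal (k₀ * Real.log (r / s)) * (g (Icc 0 s) * g (Ioi r)) ≤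
      ∫⁻ p in Ici 0 ×ˢ Ioi 0, ENNReal.ofReal (K p.1 p.2 / p.2 *
        ∫ x in p.1..(p.1 + p.2), (Ioi s).indicator (fun x => (max x s)⁻¹) x) ∂(g.prod g) := by
    rw [← Measure.prod_prod, ← setLIntegral_const]
    have hsub : (Icc 0 s ×ˢ Ioi r : Set (ℝ × ℝ)) ⊆ Ici 0 ×ˢ Ioi 0 :=
      prod_mono (fun x hx => hx.1) (Ioi_subset_Ioi (hs.le.trans hsr))
    refine le_trans ?_ (lintegral_mono_set hsub)
    refine setLIntegral_mono' (measurableSet_Icc.prod measurableSet_Ioi) ?_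
    rintro ⟨y, z⟩ ⟨⟨hy0, hys⟩, hz⟩
    simp only [mem_Ioi] at hy0 hys hz ⊢
    have hz0 : 0 < z := hs.trans (hsr.trans_lt hz)
    refine ENNReal.ofReal_le_ofReal ?_
    rw [hK y z hy0 hz0, mul_div_cancel_left₀ _ hz0.ne']
    refine mul_le_mul (hK_pos _ (div_nonneg hy0 hz0.le)) ?_
      (Real.log_nonneg ((one_le_div hs).2 hsr)) (hk₀.le.trans (hK_pos _ (div_nonneg hy0 hz0.le)))
    refine le_trans (le_of_eq ?_)
      (intervalIntegral_le_indicator hc h0 hys le_rfl hsr (by linarith))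
    rw [← integral_inv_of_pos hs (hs.trans_le hsr)]
    refine intervalIntegral.integral_congr fun x hx => ?_
    rw [uIcc_of_le hsr] at hx
    simp [max_eq_left hx.1]
  refine hlow.trans (hkey.trans ?_)
  gcongr
  calc ∫⁻ x in Ioi s, ENNReal.ofReal (x * (max x s)⁻¹) ∂g ≤ ∫⁻ _ in Ioi s, 1 ∂g := by
        refine setLIntegral_mono' measurableSet_Ioi fun x hx => ?_
        have hx' : s < x := hx
        rw [max_eq_left hx'.le, mul_inv_cancel₀ (hs.trans hx').ne', ENNReal.ofReal_one]
    _ ≤ g univ := by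
        rw [setLIntegral_one]; exact measure_mono (subset_univ _)

/-- The support of a weak solution is unbounded. -/
theorem IsWeakSolution.measure_Ioi_pos_step (hg : IsWeakSolution K b g)
    (hK_nonneg : ∀ x y : ℝ, 0 ≤ x → 0 ≤ y → 0 ≤ K x y)
    (hK : ∀ y z : ℝ, 0 ≤ y → 0 < z → K y z = z * K 1 (y / z))
    (hK_pos : ∀ ξ : ℝ, 0 ≤ ξ → k₀ ≤ K 1 ξ) (hk₀ : 0 < k₀) (hb : 0 ≤ b)
    {r : ℝ} (hr : 0 < r) (h : g (Ioi r) ≠ 0) : g (Ioi (3 / 2 * r)) ≠ 0 := by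
  intro hzero
  have hkey := hg.lintegral_le hK_nonneg hb (continuous_const (y := (1 : ℝ)))
    (fun _ => zero_le_one) (R := 3 / 2 * r) (by linarith)
  rw [setLIntegral_measure_zero _ _ hzero, mul_zero] at hkey
  -- Two sizes above `r` sum to more than `2r`, so `(y, y + z)` has a piece of length `r / 2` beyond
  -- `3r/2`.
  have hlow : ENNReal.ofReal (k₀ * (r / 2)) * (g (Ioi r) * g (Ioi r)) ≤
      ∫⁻ p in Ici 0 ×ˢ Ioi 0, ENNReal.ofReal (K p.1 p.2 / p.2 *
        ∫ x in p.1..(p.1 + p.2), (Ioi (3 / 2 * r)).indicator (fun _ => (1 : ℝ)) x)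
        ∂(g.prod g) := by
    rw [← Measure.prod_prod, ← setLIntegral_const]
    have hsub : (Ioi r ×ˢ Ioi r : Set (ℝ × ℝ)) ⊆ Ici 0 ×ˢ Ioi 0 :=
      prod_mono (fun x hx => hr.le.trans (le_of_lt hx)) (Ioi_subset_Ioi hr.le)
    refine le_trans ?_ (lintegral_mono_set hsub)
    refine setLIntegral_mono' (measurableSet_Ioi.prod measurableSet_Ioi) ?_
    rintro ⟨y, z⟩ ⟨hy, hz⟩
    simp only [mem_Ioi] at hy hz
    have hy0 : 0 < y := hr.trans hy
    have hz0 : 0 < z := hr.trans hz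
    refine ENNReal.ofReal_le_ofReal ?_
    rw [hK y z hy0.le hz0, mul_div_cancel_left₀ _ hz0.ne']
    refine mul_le_mul (hK_pos _ (div_nonneg hy0.le hz0.le)) ?_ (by linarith)
      (hk₀.le.trans (hK_pos _ (div_nonneg hy0.le hz0.le)))
    have hm : max y (3 / 2 * r) + r / 2 ≤ y + z := by
      rcases max_cases y (3 / 2 * r) with h | h <;> linarith [h.1, h.2]
    refine le_trans (le_of_eq ?_) (intervalIntegral_le_indicator
      (continuous_const (y := (1 : ℝ))) (fun _ => zero_le_one) (le_max_left y (3 / 2 * r))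
      (le_max_right _ _) (r := max y (3 / 2 * r) + r / 2) (by linarith) hm)
    simp
  have h3 := nonpos_iff_eq_zero.1 (hlow.trans hkey)
  have : 0 < k₀ * (r / 2) := by positivity
  simp [h, this.not_ge] at h3

theorem IsWeakSolution.measure_Ioi_ne_zero (hg : IsWeakSolution K b g)
    (hK_nonneg : ∀ x y : ℝ, 0 ≤ x → 0 ≤ y → 0 ≤ K x y)
    (hK : ∀ y z : ℝ, 0 ≤ y → 0 < z → K y z = z * K 1 (y / z))
    (hK_pos : ∀ ξ : ℝ, 0 ≤ ξ → k₀ ≤ K 1 ξ) (hk₀ : 0 < k₀) (hb : 0 ≤ b)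
    {r : ℝ} (hr : 0 < r) (h : g (Ioi r) ≠ 0) (R : ℝ) : g (Ioi R) ≠ 0 := by
  have hn : ∀ n : ℕ, g (Ioi ((3 / 2) ^ n * r)) ≠ 0 := by
    intro n
    induction n with
    | zero => simpa using h
    | succ n ih =>
      have := hg.measure_Ioi_pos_step hK_nonneg hK hK_pos hk₀ hb (by positivity) ih
      rwa [← mul_assoc, ← pow_succ'] at this
  obtain ⟨n, hRn⟩ := pow_unbounded_of_one_lt (R / r) (by norm_num : (1 : ℝ) < 3 / 2)
  rw [div_lt_iff₀ hr] at hRn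
  exact fun h0 => hn n (measure_mono_null (Ioi_subset_Ioi hRn.le) h0)

/-! ### The four-rectangle inequality -/

variable {α c ε : ℝ}

/-- Lower bound of the coagulation term tested with `h` restricted to `(R, ∞)`, by the
contributions of four disjoint rectangles. -/
theorem IsWeakSolution.rectangles_le (hg : IsWeakSolution K b g)
    (hK_nonneg : ∀ x y : ℝ, 0 ≤ x → 0 ≤ y → 0 ≤ K x y)
    (hK_symm : ∀ x y : ℝ, 0 ≤ x → 0 ≤ y → K x y = K y x)
    (hK : ∀ y z : ℝ, 0 ≤ y → 0 < z → K y z = z * K 1 (y / z))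
    (hα : 0 ≤ α) (hcc : 0 ≤ c) (hε0 : 0 < ε) (hε1 : ε ≤ 1)
    (hKε : ∀ ξ : ℝ, 0 < ξ → ξ ≤ ε → 1 + c * ξ ^ α ≤ K 1 ξ) (hb : 0 ≤ b)
    {h : ℝ → ℝ} (hc : Continuous h) (h0 : ∀ x, 0 ≤ h x) (hanti : AntitoneOn h (Ioi 0))
    {a : ℝ} (ha0 : 0 ≤ a) (ha : ∀ y, 0 < y → a * h y ≤ h ((1 + ε) * y))
    {R m : ℝ} (hR : 0 < R) (hm : 0 < m) (hmR : m ≤ ε * R) :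
    ENNReal.ofReal a *
        (g (Ioc 0 m) * ∫⁻ x in Ioi R, ENNReal.ofReal (x * h x) ∂g) +
      ENNReal.ofReal (a * (1 + c * (m / (2 * R)) ^ α)) *
        (g (Ioc m (ε * R)) * ∫⁻ x in Ioc R (2 * R), ENNReal.ofReal (x * h x) ∂g) +
      ENNReal.ofReal a *
        (g (Ioc m (ε * R)) * ∫⁻ x in Ioi (2 * R), ENNReal.ofReal (x * h x) ∂g) +
      ENNReal.ofReal (1 / 2) *
        (g (Ioc 0 (ε * R)) * ∫⁻ x in Ioi (2 * R), ENNReal.ofReal (x * h x) ∂g) ≤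
      ENNReal.ofReal b * ∫⁻ x in Ioi R, ENNReal.ofReal (x * h x) ∂g := by
  refine le_trans ?_ (hg.lintegral_le hK_nonneg hb hc h0 hR.le)
  set F : ℝ × ℝ → ENNReal := fun p => ENNReal.ofReal (K p.1 p.2 / p.2 *
    ∫ x in p.1..(p.1 + p.2), (Ioi R).indicator h x) with hF
  set w : ℝ → ENNReal := fun x => ENNReal.ofReal (x * h x) with hw
  have hwm : Measurable w := (continuous_id.mul hc).measurable.ennreal_ofReal
  have hεR : ε * R ≤ R := mul_le_of_le_one_left hR.le hε1
  -- Large `y`, small `z`: by symmetry `K y z = y * K 1 (z / y)`, and `h` loses at most the factor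
  -- `a` over an interval of length `z ≤ ε * y`.
  have hfar : ∀ y z : ℝ, R < y → 0 < z → z ≤ ε * R →
      a * (y * h y) * (1 + c * (z / y) ^ α) ≤
        K y z / z * ∫ x in y..(y + z), (Ioi R).indicator h x := by
    intro y z hy hz hzR
    have hy0 : 0 < y := hR.trans hy
    have hzy : z ≤ ε * y := hzR.trans (by gcongr)
    have h1 : z * h (y + z) ≤ ∫ x in y..(y + z), (Ioi R).indicator h x := by
      refine le_trans ?_
        (intervalIntegral_le_indicator hc h0 le_rfl hy.le (by linarith) le_rfl)
      have := mul_le_intervalIntegral_of_antitoneOn hc hanti hy0 (r := y + z) (by linarith)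
      simpa using this
    have h2 : a * h y ≤ h (y + z) :=
      (ha y hy0).trans (hanti (show (0 : ℝ) < y + z by positivity)
        (show (0 : ℝ) < (1 + ε) * y by positivity) (by linarith))
    have h3 := hKε (z / y) (div_pos hz hy0) ((div_le_iff₀ hy0).2 hzy)
    have h4 : (0 : ℝ) ≤ 1 + c * (z / y) ^ α := by positivity
    calc a * (y * h y) * (1 + c * (z / y) ^ α)
        = y * ((1 + c * (z / y) ^ α) * (a * h y)) := by ring
      _ ≤ y * (K 1 (z / y) * h (y + z)) := by
          refine mul_le_mul_of_nonneg_left ?_ hy0.le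
          exact mul_le_mul h3 h2 (mul_nonneg ha0 (h0 y)) (h4.trans h3)
      _ = K y z / z * (z * h (y + z)) := by
          rw [hK_symm y z hy0.le hz.le, hK z y hz.le hy0]; field_simp
      _ ≤ _ := mul_le_mul_of_nonneg_left h1
          (div_nonneg (hK_nonneg _ _ hy0.le hz.le) hz.le)
  have hrp : ∀ y z : ℝ, R < y → 0 < z → 0 ≤ (z / y) ^ α := fun y z hy hz =>
    Real.rpow_nonneg (div_nonneg hz.le (hR.trans hy).le) _
  have hB1 : ENNReal.ofReal a * (g (Ioc 0 m) * ∫⁻ x in Ioi R, w x ∂g) ≤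
      ∫⁻ p in Ioi R ×ˢ Ioc 0 m, F p ∂(g.prod g) := by
    rw [mul_comm (g _), ← setLIntegral_prod_fst hwm, ← lintegral_const_mul' _ _ (by simp)]
    refine setLIntegral_mono' (measurableSet_Ioi.prod measurableSet_Ioc) ?_
    rintro ⟨y, z⟩ ⟨hy, hz0, hzm⟩
    simp only [mem_Ioi] at hy hz0 hzm
    rw [hw, ← ENNReal.ofReal_mul ha0]
    refine ENNReal.ofReal_le_ofReal (le_trans ?_ (hfar y z hy hz0 (hzm.trans hmR)))
    refine le_mul_of_one_le_right (mul_nonneg ha0 (mul_nonneg (hR.trans hy).le (h0 y))) ?_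
    linarith [mul_nonneg hcc (hrp y z hy hz0)]
  -- Only here is the excess `c ξ^α` kept: `z > m` and `y ≤ 2R` bound `ξ = z / y` below by `m /
  -- (2R)`.
  have hB2 : ENNReal.ofReal (a * (1 + c * (m / (2 * R)) ^ α)) *
        (g (Ioc m (ε * R)) * ∫⁻ x in Ioc R (2 * R), w x ∂g) ≤
      ∫⁻ p in Ioc R (2 * R) ×ˢ Ioc m (ε * R), F p ∂(g.prod g) := by
    rw [mul_comm (g _), ← setLIntegral_prod_fst hwm, ← lintegral_const_mul' _ _ (by simp)]
    refine setLIntegral_mono' (measurableSet_Ioc.prod measurableSet_Ioc) ?_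
    rintro ⟨y, z⟩ ⟨⟨hy, hy2⟩, hz0, hzm⟩
    simp only at hy hy2 hz0 hzm
    have hz : 0 < z := hm.trans hz0
    rw [hw, ← ENNReal.ofReal_mul (by positivity)]
    refine ENNReal.ofReal_le_ofReal (le_trans ?_ (hfar y z hy hz hzm))
    have hle : (m / (2 * R)) ^ α ≤ (z / y) ^ α := by
      refine Real.rpow_le_rpow (by positivity) ?_ hα
      exact div_le_div₀ hz.le hz0.le (hR.trans hy) hy2
    have : 0 ≤ a * (y * h y) := mul_nonneg ha0 (mul_nonneg (hR.trans hy).le (h0 y))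
    calc a * (1 + c * (m / (2 * R)) ^ α) * (y * h y)
        = a * (y * h y) * (1 + c * (m / (2 * R)) ^ α) := by ring
      _ ≤ _ := by gcongr
  have hB3 : ENNReal.ofReal a * (g (Ioc m (ε * R)) * ∫⁻ x in Ioi (2 * R), w x ∂g) ≤
      ∫⁻ p in Ioi (2 * R) ×ˢ Ioc m (ε * R), F p ∂(g.prod g) := by
    rw [mul_comm (g _), ← setLIntegral_prod_fst hwm, ← lintegral_const_mul' _ _ (by simp)]
    refine setLIntegral_mono' (measurableSet_Ioi.prod measurableSet_Ioc) ?_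
    rintro ⟨y, z⟩ ⟨hy2, hz0, hzm⟩
    simp only [mem_Ioi] at hy2 hz0 hzm
    have hy : R < y := by linarith
    have hz : 0 < z := hm.trans hz0
    rw [hw, ← ENNReal.ofReal_mul ha0]
    refine ENNReal.ofReal_le_ofReal (le_trans ?_ (hfar y z hy hz hzm))
    refine le_mul_of_one_le_right (mul_nonneg ha0 (mul_nonneg (hR.trans hy).le (h0 y))) ?_
    linarith [mul_nonneg hcc (hrp y z hy hz)]
  -- Small `y`, large `z`: `(y, y + z)` contains `(R, z)`, of length at least `z / 2` because `z >
  -- 2R`.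
  have hB4 : ENNReal.ofReal (1 / 2) * (g (Ioc 0 (ε * R)) * ∫⁻ x in Ioi (2 * R), w x ∂g) ≤
      ∫⁻ p in Ioc 0 (ε * R) ×ˢ Ioi (2 * R), F p ∂(g.prod g) := by
    rw [← setLIntegral_prod_snd hwm, ← lintegral_const_mul' _ _ (by simp)]
    refine setLIntegral_mono' (measurableSet_Ioc.prod measurableSet_Ioi) ?_
    rintro ⟨y, z⟩ ⟨⟨hy0, hy⟩, hz⟩
    simp only [mem_Ioi] at hy0 hy hz
    have hz0 : 0 < z := by linarith
    rw [hw, ← ENNReal.ofReal_mul (by norm_num)]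
    refine ENNReal.ofReal_le_ofReal ?_
    have hzz : ε * R ≤ ε * z := by gcongr; linarith
    have h3 := hKε (y / z) (div_pos hy0 hz0) ((div_le_iff₀ hz0).2 (hy.trans hzz))
    have h4 : 0 ≤ c * (y / z) ^ α := by positivity
    have h5 : 1 / 2 * (z * h z) ≤ ∫ x in y..(y + z), (Ioi R).indicator h x := by
      refine le_trans ?_ (intervalIntegral_le_indicator hc h0 (hy.trans hεR) le_rfl
        (r := z) (by linarith) (by linarith))
      refine le_trans ?_ (mul_le_intervalIntegral_of_antitoneOn hc hanti hR (by linarith))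
      rw [← mul_assoc]
      exact mul_le_mul_of_nonneg_right (by linarith) (h0 z)
    rw [hK y z hy0.le hz0, mul_div_cancel_left₀ _ hz0.ne']
    refine h5.trans (le_mul_of_one_le_left ?_ (by linarith))
    exact le_trans (mul_nonneg (by norm_num) (mul_nonneg hz0.le (h0 z))) h5
  refine (add_le_add (add_le_add (add_le_add hB1 hB2) hB3) hB4).trans ?_
  rw [← lintegral_union (measurableSet_Ioc.prod measurableSet_Ioc),
    ← lintegral_union (measurableSet_Ioi.prod measurableSet_Ioc),
    ← lintegral_union (measurableSet_Ioc.prod measurableSet_Ioi)]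
  · refine lintegral_mono_set ?_
    rintro ⟨y, z⟩ (((⟨hy, hz⟩ | ⟨hy, hz⟩) | ⟨hy, hz⟩) | ⟨hy, hz⟩) <;>
      simp only [mem_Ioi, mem_Ioc, mem_prod, mem_Ici] at hy hz ⊢ <;>
      constructor <;> linarith
  all_goals
    rw [Set.disjoint_left]
    rintro ⟨y, z⟩ h h'
    simp only [mem_union, mem_Ioi, mem_Ioc, mem_prod] at h h'
    grind

/-- Real-valued form of `IsWeakSolution.rectangles_le`. -/
theorem IsWeakSolution.rectangles_le_real (hg : IsWeakSolution K b g)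
    (hK_nonneg : ∀ x y : ℝ, 0 ≤ x → 0 ≤ y → 0 ≤ K x y)
    (hK_symm : ∀ x y : ℝ, 0 ≤ x → 0 ≤ y → K x y = K y x)
    (hK : ∀ y z : ℝ, 0 ≤ y → 0 < z → K y z = z * K 1 (y / z))
    (hα : 0 ≤ α) (hcc : 0 ≤ c) (hε0 : 0 < ε) (hε1 : ε ≤ 1)
    (hKε : ∀ ξ : ℝ, 0 < ξ → ξ ≤ ε → 1 + c * ξ ^ α ≤ K 1 ξ) (hb : 0 ≤ b)
    {h : ℝ → ℝ} (hc : Continuous h) (h0 : ∀ x, 0 ≤ h x) (hanti : AntitoneOn h (Ioi 0))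
    {a : ℝ} (ha0 : 0 ≤ a) (ha : ∀ y, 0 < y → a * h y ≤ h ((1 + ε) * y))
    {R m : ℝ} (hR : 0 < R) (hm : 0 < m) (hmR : m ≤ ε * R)
    (hfin : ∫⁻ x in Ioi R, ENNReal.ofReal (x * h x) ∂g ≠ ⊤) :
    ∃ u v : ℝ, 0 ≤ u ∧ 0 ≤ v ∧
      ∫⁻ x in Ioc R (2 * R), ENNReal.ofReal (x * h x) ∂g = ENNReal.ofReal u ∧
      ∫⁻ x in Ioi R, ENNReal.ofReal (x * h x) ∂g = ENNReal.ofReal (u + v) ∧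
      a * (g.real (Ioc 0 m) * (u + v)) +
        a * (1 + c * (m / (2 * R)) ^ α) * (g.real (Ioc m (ε * R)) * u) +
        a * (g.real (Ioc m (ε * R)) * v) +
        1 / 2 * (g.real (Ioc 0 (ε * R)) * v) ≤ b * (u + v) := by
  have hmain := hg.rectangles_le hK_nonneg hK_symm hK hα hcc hε0 hε1 hKε hb hc h0 hanti ha0 ha
    hR hm hmR
  have hsplit : ∫⁻ x in Ioi R, ENNReal.ofReal (x * h x) ∂g =
      ∫⁻ x in Ioc R (2 * R), ENNReal.ofReal (x * h x) ∂g +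
        ∫⁻ x in Ioi (2 * R), ENNReal.ofReal (x * h x) ∂g := by
    rw [← lintegral_union measurableSet_Ioi (Ioc_disjoint_Ioi le_rfl),
      Ioc_union_Ioi_eq_Ioi (by linarith)]
  rw [hsplit] at hmain hfin ⊢
  obtain ⟨hu, hv⟩ := ENNReal.add_ne_top.1 hfin
  have hreal : ∀ t : ENNReal, t ≠ ⊤ → ∃ r : ℝ, 0 ≤ r ∧ t = ENNReal.ofReal r := fun t ht =>
    ⟨t.toReal, ENNReal.toReal_nonneg, (ENNReal.ofReal_toReal ht).symm⟩
  obtain ⟨u, hu0, hu⟩ := hreal _ hu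
  obtain ⟨v, hv0, hv⟩ := hreal _ hv
  rw [hu, hv, ← ENNReal.ofReal_add hu0 hv0] at hmain
  refine ⟨u, v, hu0, hv0, hu, by rw [hu, hv, ENNReal.ofReal_add hu0 hv0], ?_⟩
  have hpos : 0 ≤ a * (1 + c * (m / (2 * R)) ^ α) := by positivity
  have hgr : ∀ A : Set ℝ, g A = ENNReal.ofReal (g.real A) := fun A => by simp [Measure.real]
  rw [hgr, hgr, hgr] at hmain
  rw [← ENNReal.ofReal_le_ofReal_iff (by positivity)]
  convert hmain using 1
  · rw [ENNReal.ofReal_add (by positivity) (by positivity),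
      ENNReal.ofReal_add (by positivity) (by positivity),
      ENNReal.ofReal_add (by positivity) (by positivity),
      ENNReal.ofReal_mul (p := 1 / 2) (by norm_num)]
    simp only [ENNReal.ofReal_mul ha0, ENNReal.ofReal_mul hpos,
      ENNReal.ofReal_mul measureReal_nonneg]
  · rw [ENNReal.ofReal_mul hb]

end Solution

/-! ### Choice of scale and final balance -/

theorem setLIntegral_ofReal_mul_le {g : Measure ℝ} [IsProbabilityMeasure g] {f : ℝ → ℝ} {C : ℝ}
    {A : Set ℝ} (hA : MeasurableSet A) (hf : ∀ x ∈ A, f x ≤ C) :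
    ∫⁻ x in A, ENNReal.ofReal (f x) ∂g ≤ ENNReal.ofReal C := by
  refine (setLIntegral_mono' hA fun x hx => ENNReal.ofReal_le_ofReal (hf x hx)).trans ?_
  rw [setLIntegral_const]
  exact mul_le_of_le_one_right' prob_le_one

theorem eq_dirac_zero_of_measure_Ioi_eq_zero {g : Measure ℝ} [IsProbabilityMeasure g]
    (h1 : g (Iio 0) = 0) (h2 : g (Ioi 0) = 0) : g = Measure.dirac 0 := by
  have hc : g ({0}ᶜ) = 0 := by
    rw [← Iio_union_Ioi]; exact measure_union_null h1 h2
  have h0 : g {0} = 1 := (prob_compl_eq_zero_iff (measurableSet_singleton 0)).1 hc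
  have h := Measure.restrict_eq_self_of_ae_mem (μ := g) (s := {0}) hc
  rw [Measure.restrict_singleton, h0, one_smul] at h
  exact h.symm

/-- The tail bound decays like `1/N` and the kernel gain only like `N^(-α)`; since `α < 1`, the gain
wins for large `N`. -/
theorem exists_scale_constant {α c ε Λ : ℝ} (hα₁ : α < 1) (hc : 0 < c) :
    ∃ N : ℝ, Λ / ε ^ 2 ≤ N ∧ 1 / ε ≤ N ∧ 0 < N ∧
      4 * Λ / (ε ^ 2 * N) ≤ c * (1 / (4 * N)) ^ α / 16 ∧ 4 * Λ / (ε ^ 2 * N) ≤ 1 / 16 := by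
  have h4 : Tendsto (fun N : ℝ => 4 * N) atTop atTop :=
    tendsto_id.const_mul_atTop (by norm_num)
  have h1 : Tendsto (fun N : ℝ => 256 * Λ / ε ^ 2 * (4 * N) ^ (-(1 - α))) atTop (𝓝 0) := by
    have := ((tendsto_rpow_neg_atTop (y := 1 - α) (by linarith)).comp h4).const_mul
      (256 * Λ / ε ^ 2)
    simpa using this
  have h2 : Tendsto (fun N : ℝ => 4 * Λ / ε ^ 2 * N⁻¹) atTop (𝓝 0) := by
    have := (tendsto_inv_atTop_zero (𝕜 := ℝ)).const_mul (4 * Λ / ε ^ 2)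
    rwa [mul_zero] at this
  obtain ⟨N, hN1, hN2, hN3, hN4, hN0⟩ := ((h1.eventually (ge_mem_nhds hc)).and
    ((h2.eventually (ge_mem_nhds (by norm_num : (0 : ℝ) < 1 / 16))).and
    ((eventually_ge_atTop (Λ / ε ^ 2)).and
    ((eventually_ge_atTop (1 / ε)).and (eventually_gt_atTop (0 : ℝ)))))).exists
  have he : 4 * Λ / (ε ^ 2 * N) = 4 * Λ / ε ^ 2 * N⁻¹ := by
    rw [← div_div, div_eq_mul_inv (4 * Λ / ε ^ 2)]
  refine ⟨N, hN3, hN4, hN0, ?_, by rwa [he]⟩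
  have hM : 0 < 4 * N := by linarith
  have hp : (0 : ℝ) < (1 / (4 * N)) ^ α := by positivity
  have hs : (4 * N) ^ (-(1 - α)) * (1 / (4 * N)) ^ α = (4 * N)⁻¹ := by
    rw [one_div, Real.inv_rpow hM.le, ← Real.rpow_neg hM.le, ← Real.rpow_add hM,
      show -(1 - α) + -α = -1 by ring, Real.rpow_neg_one]
  have := mul_le_mul_of_nonneg_right hN1 hp.le
  rw [mul_assoc, hs] at this
  have h5 : 256 * Λ / ε ^ 2 * (4 * N)⁻¹ = 16 * (4 * Λ / ε ^ 2 * N⁻¹) := by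
    rw [mul_inv]; ring
  rw [h5] at this
  rw [he]
  linarith

/-- Subtracting `(1 - T)(u + v)` leaves a gain of at least `7/16 κ u + 1/2 (1 - T) v` against `(b -
1 + T)(u + v)`, where `b - 1 + T` is at most both `κ/8` and `1/8`. -/
theorem eq_zero_and_eq_zero_of_balance {u v κ b T G G₁ G₂ : ℝ} (hu : 0 ≤ u) (hv : 0 ≤ v)
    (hκ : 0 < κ) (hb : b ≤ 17 / 16) (hbκ : b ≤ 1 + κ / 16) (hTκ : T ≤ κ / 16)
    (hT1 : T ≤ 1 / 16) (hG₁ : G₁ = 1 - T - G₂) (hG₂ : 7 / 16 ≤ G₂) (hG : G = 1 - T)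
    (h : 1 * (G₁ * (u + v)) + 1 * (1 + κ) * (G₂ * u) + 1 * (G₂ * v) + 1 / 2 * (G * v) ≤
      b * (u + v)) : u = 0 ∧ v = 0 := by
  have hκu : 0 ≤ κ * u := mul_nonneg hκ.le hu
  have e1 : 7 / 16 * (κ * u) ≤ G₂ * (κ * u) := mul_le_mul_of_nonneg_right hG₂ hκu
  have e2 : (b - 1 + T) * u ≤ κ / 8 * u := mul_le_mul_of_nonneg_right (by linarith) hu
  have e3 : (b - 1 + T) * v ≤ 1 / 8 * v := mul_le_mul_of_nonneg_right (by linarith) hv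
  have e4 : T * v ≤ 1 / 16 * v := mul_le_mul_of_nonneg_right hT1 hv
  rw [hG₁, hG] at h
  have hκu0 : κ * u = 0 := by linarith
  exact ⟨(mul_eq_zero.1 hκu0).resolve_left hκ.ne', by linarith⟩

/-! ### First moment, mass near zero and median -/

section Solution

variable {K : ℝ → ℝ → ℝ} {b k₀ : ℝ} {g : Measure ℝ} [IsProbabilityMeasure g] {α c ε : ℝ}

/-- A first moment bound on every scale beyond which `g` has little mass. -/
theorem IsWeakSolution.first_moment_le (hg : IsWeakSolution K b g)
    (hK_nonneg : ∀ x y : ℝ, 0 ≤ x → 0 ≤ y → 0 ≤ K x y)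
    (hK_symm : ∀ x y : ℝ, 0 ≤ x → 0 ≤ y → K x y = K y x)
    (hK : ∀ y z : ℝ, 0 ≤ y → 0 < z → K y z = z * K 1 (y / z))
    (hα : 0 ≤ α) (hcc : 0 ≤ c) (hε0 : 0 < ε) (hε1 : ε ≤ 1 / 16)
    (hKε : ∀ ξ : ℝ, 0 < ξ → ξ ≤ ε → 1 + c * ξ ^ α ≤ K 1 ξ) (hb : 0 ≤ b) (hb1 : b ≤ 17 / 16)
    {R : ℝ} (hR : 0 < R) (hmass : 15 / 16 ≤ g.real (Ioc 0 (ε * R))) :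
    ∫⁻ x in Ioi R, ENNReal.ofReal x ∂g ≤ ENNReal.ofReal (4 * R) := by
  -- The truncated weight is at most `X`, so the moments are finite and can be absorbed; the bound
  -- is uniform in `X`, and Fatou removes the truncation.
  have htrunc : ∀ X : ℝ, 0 < X →
      ∫⁻ x in Ioi R, ENNReal.ofReal (x * (X / max x X)) ∂g ≤ ENNReal.ofReal (4 * R) := by
    intro X hX
    have hmax : ∀ x, 0 < max x X := fun x => hX.trans_le (le_max_right _ _)
    have hc : Continuous fun x : ℝ => X / max x X :=
      continuous_const.div (continuous_id.max continuous_const) fun x => (hmax x).ne'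
    have h0 : ∀ x : ℝ, 0 ≤ X / max x X := fun x => (div_pos hX (hmax x)).le
    have hanti : AntitoneOn (fun x : ℝ => X / max x X) (Ioi 0) := fun x _ y _ hxy =>
      div_le_div_of_nonneg_left hX.le (hmax x) (max_le_max_right X hxy)
    have ha : ∀ y, 0 < y → 16 / 17 * (X / max y X) ≤ X / max ((1 + ε) * y) X := by
      intro y hy
      rw [mul_div_assoc', div_le_div_iff₀ (hmax y) (hmax _)]
      have : max ((1 + ε) * y) X ≤ 17 / 16 * max y X := by
        refine max_le ?_ ?_
        · exact mul_le_mul (by linarith) (le_max_left _ _) hy.le (by norm_num)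
        · linarith [le_max_right y X]
      nlinarith
    have hle1 : ∀ x, X / max x X ≤ 1 := fun x => (div_le_one (hmax x)).2 (le_max_right _ _)
    have hfin : ∫⁻ x in Ioi R, ENNReal.ofReal (x * (X / max x X)) ∂g ≠ ⊤ := by
      refine ne_top_of_le_ne_top ENNReal.ofReal_ne_top
        (setLIntegral_ofReal_mul_le (C := X) measurableSet_Ioi fun x hx => ?_)
      rw [mul_div_assoc', div_le_iff₀ (hmax x), mul_comm]
      exact mul_le_mul_of_nonneg_left (le_max_left _ _) hX.le
    -- With `m = ε * R` the two middle rectangles are empty; the `ξ^α` gain is not needed here.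
    obtain ⟨u, v, hu, hv, hu', huv, h⟩ := hg.rectangles_le_real hK_nonneg hK_symm hK hα hcc hε0
      (hε1.trans (by norm_num)) hKε hb hc h0 hanti (by norm_num) ha hR (m := ε * R)
      (by positivity) le_rfl hfin
    rw [huv]
    have hu2 : u ≤ 2 * R := by
      rw [← ENNReal.ofReal_le_ofReal_iff (by linarith), ← hu']
      refine setLIntegral_ofReal_mul_le measurableSet_Ioc fun x hx => ?_
      exact (mul_le_of_le_one_right (hR.trans hx.1).le (hle1 x)).trans hx.2
    simp only [Ioc_self, measureReal_empty, zero_mul, mul_zero, add_zero] at h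
    refine ENNReal.ofReal_le_ofReal ?_
    -- These give `15/17 (u + v) + 15/32 v ≤ 17/16 (u + v)`, hence `v ≤ u`, while `u ≤ 2R`.
    have e1 : 15 / 16 * (u + v) ≤ g.real (Ioc 0 (ε * R)) * (u + v) := by gcongr
    have e2 : 15 / 16 * v ≤ g.real (Ioc 0 (ε * R)) * v := by gcongr
    have e3 : b * (u + v) ≤ 17 / 16 * (u + v) := by gcongr
    linarith
  calc ∫⁻ x in Ioi R, ENNReal.ofReal x ∂g
      = ∫⁻ x in Ioi R, liminf (fun n : ℕ =>
          ENNReal.ofReal (x * (((n : ℝ) + 1) / max x ((n : ℝ) + 1)))) atTop ∂g := by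
        refine lintegral_congr fun x => (Tendsto.liminf_eq ?_).symm
        refine tendsto_const_nhds.congr' ?_
        filter_upwards [tendsto_natCast_atTop_atTop.eventually_ge_atTop x] with n hn
        rw [max_eq_right (by linarith), div_self (by positivity), mul_one]
    _ ≤ liminf (fun n : ℕ => ∫⁻ x in Ioi R,
          ENNReal.ofReal (x * (((n : ℝ) + 1) / max x ((n : ℝ) + 1))) ∂g) atTop :=
        lintegral_liminf_le fun n => by fun_prop
    _ ≤ _ := liminf_le_of_frequently_le' (Frequently.of_forall fun n => htrunc _ (by positivity))

theorem IsWeakSolution.log_mul_measureReal_le (hg : IsWeakSolution K b g)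
    (hK_nonneg : ∀ x y : ℝ, 0 ≤ x → 0 ≤ y → 0 ≤ K x y)
    (hK : ∀ y z : ℝ, 0 ≤ y → 0 < z → K y z = z * K 1 (y / z))
    (hK_pos : ∀ ξ : ℝ, 0 ≤ ξ → k₀ ≤ K 1 ξ) (hk₀ : 0 < k₀) (hb : 0 ≤ b) (h_neg : g (Iio 0) = 0)
    {s r : ℝ} (hs : 0 < s) (hsr : s ≤ r) :
    k₀ * Real.log (r / s) * (g.real (Iic s) * g.real (Ioi r)) ≤ b := by
  have h := hg.log_mul_measure_le hK_nonneg hK hK_pos hk₀ hb hs hsr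
  have hI : g (Icc 0 s) = g (Iic s) := by
    refine measure_congr ?_
    have : ∀ᵐ x ∂g, x ∉ Iio (0 : ℝ) := measure_eq_zero_iff_ae_notMem.1 h_neg
    filter_upwards [this] with x hx
    simp only [mem_Iio, not_lt] at hx
    exact propext ⟨fun h => h.2, fun h => ⟨hx, h⟩⟩
  have hgr : ∀ A : Set ℝ, g A = ENNReal.ofReal (g.real A) := fun A => by simp [Measure.real]
  rw [measure_univ, mul_one, hI, hgr, hgr, ← ENNReal.ofReal_mul measureReal_nonneg,
    ← ENNReal.ofReal_mul
      (mul_nonneg hk₀.le (Real.log_nonneg ((one_le_div hs).2 hsr))),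
    ENNReal.ofReal_le_ofReal_iff hb] at h
  exact h

/-- With some mass beyond `r` fixed, `log (r/s)` diverges as `s → 0` and forces the mass of `[0, s]`
to vanish; this rules out an atom at `0`. -/
theorem IsWeakSolution.exists_measureReal_Iic_le (hg : IsWeakSolution K b g)
    (hK_nonneg : ∀ x y : ℝ, 0 ≤ x → 0 ≤ y → 0 ≤ K x y)
    (hK : ∀ y z : ℝ, 0 ≤ y → 0 < z → K y z = z * K 1 (y / z))
    (hK_pos : ∀ ξ : ℝ, 0 ≤ ξ → k₀ ≤ K 1 ξ) (hk₀ : 0 < k₀) (hb : 0 < b) (h_neg : g (Iio 0) = 0)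
    {r : ℝ} (hr : 0 < r) (h : g (Ioi r) ≠ 0) {δ : ℝ} (hδ : 0 < δ) :
    ∃ s : ℝ, 0 < s ∧ g.real (Iic s) ≤ δ := by
  have hT : 0 < g.real (Ioi r) := ENNReal.toReal_pos h (measure_ne_top _ _)
  set L := b / (k₀ * g.real (Ioi r) * δ) with hL
  have hL0 : 0 < L := by positivity
  refine ⟨r * Real.exp (-L), by positivity, ?_⟩
  have := hg.log_mul_measureReal_le hK_nonneg hK hK_pos hk₀ hb.le h_neg (s := r * Real.exp (-L))
    (r := r) (by positivity) (mul_le_of_le_one_right hr.le (Real.exp_le_one_iff.2 (by linarith)))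
  have hlog : Real.log (r / (r * Real.exp (-L))) = L := by
    rw [div_mul_cancel_left₀ hr.ne', ← Real.exp_neg, neg_neg, Real.log_exp]
  rw [hlog] at this
  have h2 : b = k₀ * L * (δ * g.real (Ioi r)) := by rw [hL]; field_simp
  rw [h2] at this
  have h3 : 0 < k₀ * L := by positivity
  exact le_of_mul_le_mul_right (le_of_mul_le_mul_left this h3) hT

/-- A median up to a factor `2`. -/
theorem exists_dyadic_median {s : ℝ} (hs : 0 < s) (h : g.real (Iic s) < 1 / 2) :
    ∃ m : ℝ, 0 < m ∧ g.real (Iic m) < 1 / 2 ∧ 1 / 2 ≤ g.real (Iic (2 * m)) := by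
  have hlim : Tendsto (fun n : ℕ => g.real (Iic (2 ^ n * s))) atTop (𝓝 1) := by
    have h1 : Tendsto (fun n : ℕ => (2 : ℝ) ^ n * s) atTop atTop :=
      (tendsto_pow_atTop_atTop_of_one_lt (by norm_num)).atTop_mul_const hs
    have h2 := (tendsto_measure_Iic_atTop g).comp h1
    rw [measure_univ] at h2
    exact (ENNReal.tendsto_toReal ENNReal.one_ne_top).comp h2
  have hex : ∃ n : ℕ, 1 / 2 ≤ g.real (Iic (2 ^ n * s)) :=
    (hlim.eventually (le_mem_nhds (by norm_num : (1 / 2 : ℝ) < 1))).exists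
  classical
  have hspec := Nat.find_spec hex
  have hne : Nat.find hex ≠ 0 := by
    intro h0
    rw [h0, pow_zero, one_mul] at hspec
    linarith
  obtain ⟨k, hk⟩ := Nat.exists_eq_succ_of_ne_zero hne
  refine ⟨2 ^ k * s, by positivity, not_le.1 (Nat.find_min hex (by omega)), ?_⟩
  rw [hk, pow_succ'] at hspec
  rwa [← mul_assoc]

end Solution

/-! ### Uniqueness for `b` near `1` -/

/-- For `b` close to `1`, there is no weak solution of unit mass other than the Dirac measure. -/
theorem exists_eq_dirac_of_isWeakSolution {K : ℝ → ℝ → ℝ}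
    (hK_nonneg : ∀ x y : ℝ, 0 ≤ x → 0 ≤ y → 0 ≤ K x y)
    (hK_symm : ∀ x y : ℝ, 0 ≤ x → 0 ≤ y → K x y = K y x)
    (hK : ∀ y z : ℝ, 0 ≤ y → 0 < z → K y z = z * K 1 (y / z))
    {α c ε k₀ : ℝ} (hα₀ : 0 < α) (hα₁ : α < 1) (hcc : 0 < c) (hk₀ : 0 < k₀)
    (hK_pos : ∀ ξ : ℝ, 0 ≤ ξ → k₀ ≤ K 1 ξ) (hε0 : 0 < ε) (hε1 : ε ≤ 1 / 16)
    (hKε : ∀ ξ : ℝ, 0 < ξ → ξ ≤ ε → 1 + c * ξ ^ α ≤ K 1 ξ) :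
    ∃ bStar : ℝ, 1 < bStar ∧ ∀ b : ℝ, 1 < b → b < bStar → ∀ g : Measure ℝ,
      IsRadonOnHalfLine g → g univ = 1 → IsWeakSolution K b g → g = Measure.dirac 0 := by
  -- Then `k₀ * log Λ = 64`, and the mass beyond `Λ * (2 * m)` is at most `b / 32`.
  set Λ : ℝ := Real.exp (64 / k₀) with hΛ
  have hΛ1 : 1 ≤ Λ := Real.one_le_exp (by positivity)
  obtain ⟨N, hN1, hN2, hN0, hN3, hN4⟩ := exists_scale_constant (ε := ε) (Λ := Λ) hα₁ hcc
  set κ := c * (1 / (4 * N)) ^ α with hκ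
  have hκ0 : 0 < κ := by positivity
  refine ⟨1 + min (1 / 16) (κ / 16), by
    have : 0 < min (1 / 16) (κ / 16) := by positivity
    linarith, fun b hb1 hb2 g hrad hmass hg => ?_⟩
  have : IsProbabilityMeasure g := ⟨hmass⟩
  have hb17 : b ≤ 17 / 16 := by linarith [min_le_left (1 / 16) (κ / 16)]
  have hbκ : b ≤ 1 + κ / 16 := by linarith [min_le_right (1 / 16) (κ / 16)]
  have hb0 : 0 < b := by linarith
  have h_neg := hrad.null_neg
  by_contra hne
  have hpos : g (Ioi 0) ≠ 0 := fun h0 => hne (eq_dirac_zero_of_measure_Ioi_eq_zero h_neg h0)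
  obtain ⟨r, hr, hgr⟩ : ∃ r : ℝ, 0 < r ∧ g (Ioi r) ≠ 0 := by
    by_contra! hall
    refine hpos (measure_mono_null (t := ⋃ n : ℕ, Ioi (1 / ((n : ℝ) + 1))) ?_
      (measure_iUnion_null fun n => hall _ (by positivity)))
    intro x hx
    obtain ⟨n, hn⟩ := exists_nat_one_div_lt (show (0 : ℝ) < x from hx)
    exact mem_iUnion.2 ⟨n, hn⟩
  have hsmall := fun {δ : ℝ} (hδ : 0 < δ) =>
    hg.exists_measureReal_Iic_le hK_nonneg hK hK_pos hk₀ hb0 h_neg hr hgr hδ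
  have hzero : g (Iic 0) = 0 := by
    have : g.real (Iic 0) ≤ 0 := le_of_forall_pos_le_add fun δ hδ => by
      obtain ⟨s, hs, hs'⟩ := hsmall hδ
      rw [zero_add]
      exact (measureReal_mono (Iic_subset_Iic.2 hs.le)).trans hs'
    exact (measureReal_eq_zero_iff).1 (le_antisymm this measureReal_nonneg)
  have hIoc : ∀ x : ℝ, 0 ≤ x → g.real (Ioc 0 x) = g.real (Iic x) := fun x hx => by
    have : Iic x \ Iic 0 = Ioc 0 x := by ext; simp [and_comm]
    rw [← this, measureReal_def, measure_sdiff_null hzero, measureReal_def]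
  have hIoi : ∀ x : ℝ, g.real (Iic x) = 1 - g.real (Ioi x) := fun x => by
    rw [← compl_Ioi, probReal_compl_eq_one_sub measurableSet_Ioi]
  obtain ⟨s, hs, hs'⟩ := hsmall (δ := 1 / 4) (by norm_num)
  obtain ⟨m, hm, hm1, hm2⟩ := exists_dyadic_median (g := g) hs (by linarith)
  have htail : g.real (Ioi (Λ * (2 * m))) ≤ 1 / 16 := by
    have h := hg.log_mul_measureReal_le hK_nonneg hK hK_pos hk₀ hb0.le h_neg (s := 2 * m)
      (r := Λ * (2 * m)) (by positivity) (le_mul_of_one_le_left (by positivity) hΛ1)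
    rw [mul_div_cancel_right₀ _ (by positivity), hΛ, Real.log_exp, mul_div_cancel₀ _ hk₀.ne',
      ← hΛ] at h
    have h2 : 1 / 2 * g.real (Ioi (Λ * (2 * m))) ≤
        g.real (Iic (2 * m)) * g.real (Ioi (Λ * (2 * m))) := by gcongr
    linarith
  -- Chosen so that `ε * R₀` is the scale beyond which the mass is at most `1/16`.
  set R₀ := Λ * (2 * m) / ε with hR₀
  have hR₀0 : 0 < R₀ := by positivity
  have hmom : ∫⁻ x in Ioi R₀, ENNReal.ofReal x ∂g ≤ ENNReal.ofReal (4 * R₀) := by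
    refine hg.first_moment_le hK_nonneg hK_symm hK hα₀.le hcc.le hε0 hε1 hKε hb0.le hb17 hR₀0 ?_
    rw [hIoc _ (by positivity), hR₀, mul_div_cancel₀ _ hε0.ne', hIoi]
    linarith
  set R := N * (2 * m) with hR
  have hR0 : 0 < R := by positivity
  have hR₀R : R₀ ≤ ε * R := by
    rw [div_le_iff₀ (by positivity)] at hN1
    rw [hR₀, hR, div_le_iff₀ hε0]
    calc Λ * (2 * m) ≤ N * ε ^ 2 * (2 * m) := by gcongr
      _ = _ := by ring
  have hεR : ε * R ≤ R := mul_le_of_le_one_left hR0.le (by linarith)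
  -- Markov's inequality on `(εR, ∞) ⊆ (R₀, ∞)`.
  have hT : g.real (Ioi (ε * R)) ≤ 4 * Λ / (ε ^ 2 * N) := by
    have h1 : ENNReal.ofReal (ε * R) * g (Ioi (ε * R)) ≤ ENNReal.ofReal (4 * R₀) := by
      refine le_trans ?_ hmom
      rw [← setLIntegral_const]
      refine (setLIntegral_mono' measurableSet_Ioi fun x hx => ?_).trans
        (lintegral_mono_set (Ioi_subset_Ioi hR₀R))
      exact ENNReal.ofReal_le_ofReal (le_of_lt hx)
    rw [← ofReal_measureReal, ← ENNReal.ofReal_mul (by positivity),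
      ENNReal.ofReal_le_ofReal_iff (by positivity)] at h1
    rw [le_div_iff₀ (by positivity)]
    have h4 : ε * R₀ = Λ * (2 * m) := by rw [hR₀]; field_simp
    have h5 : (2 * m) * (g.real (Ioi (ε * R)) * (ε ^ 2 * N)) ≤ (2 * m) * (4 * Λ) := by
      calc _ = ε * (ε * R * g.real (Ioi (ε * R))) := by rw [hR]; ring
        _ ≤ ε * (4 * R₀) := by gcongr
        _ = 4 * (ε * R₀) := by ring
        _ = _ := by rw [h4]; ring
    exact le_of_mul_le_mul_left h5 (by positivity)
  have hmR : m ≤ ε * R := by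
    rw [div_le_iff₀ hε0] at hN2
    have : 1 * (2 * m) ≤ N * ε * (2 * m) := by gcongr
    rw [hR]; linarith
  have hfin : ∫⁻ x in Ioi R, ENNReal.ofReal (x * 1) ∂g ≠ ⊤ := by
    simp only [mul_one]
    exact ne_top_of_le_ne_top ENNReal.ofReal_ne_top
      ((lintegral_mono_set (Ioi_subset_Ioi (hR₀R.trans hεR))).trans hmom)
  obtain ⟨u, v, hu, hv, -, huv, h⟩ := hg.rectangles_le_real hK_nonneg hK_symm hK hα₀.le hcc.le hε0
    (by linarith) hKε hb0.le (continuous_const (y := (1 : ℝ))) (fun _ => zero_le_one)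
    (fun _ _ _ _ _ => le_rfl) zero_le_one (fun _ _ => by norm_num) hR0 hm hmR hfin
  -- The ratio `m / (2 * R)` is `1 / (4 * N)`: the unknown median cancels.
  have hκR : c * (m / (2 * R)) ^ α = κ := by
    rw [hκ, hR]; congr 2; field_simp; norm_num
  have hsum : g.real (Ioc 0 (ε * R)) = g.real (Ioc 0 m) + g.real (Ioc m (ε * R)) := by
    rw [← measureReal_union (Ioc_disjoint_Ioc_of_le le_rfl) measurableSet_Ioc,
      Ioc_union_Ioc_eq_Ioc hm.le hmR]
  have hG : g.real (Ioc 0 (ε * R)) = 1 - g.real (Ioi (ε * R)) := by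
    rw [hIoc _ (by positivity), hIoi]
  have hg1 : g.real (Ioc 0 m) < 1 / 2 := by rwa [hIoc _ hm.le]
  rw [hκR] at h
  set G₁ := g.real (Ioc 0 m)
  set G₂ := g.real (Ioc m (ε * R))
  set T := g.real (Ioi (ε * R))
  have hG₁ : G₁ = 1 - T - G₂ := by linarith
  have hG₂ : 7 / 16 ≤ G₂ := by linarith
  obtain ⟨hu0, hv0⟩ := eq_zero_and_eq_zero_of_balance hu hv hκ0
    (by linarith) hbκ (hT.trans hN3) (hT.trans hN4) hG₁ hG₂ hG h
  rw [hu0, hv0, add_zero, ENNReal.ofReal_zero, lintegral_eq_zero_iff (by fun_prop)] at huv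
  have hgR := hg.measure_Ioi_ne_zero hK_nonneg hK hK_pos hk₀ hb0.le hr hgr R
  refine hgR ?_
  rw [Filter.EventuallyEq, ae_restrict_iff' measurableSet_Ioi] at huv
  refine measure_mono_null (fun x hx => ?_) (ae_iff.1 huv)
  have hx' : R < x := hx
  simp only [mem_ofPred_eq, Classical.not_imp]
  refine ⟨hx, ?_⟩
  simp only [mul_one, Pi.zero_apply, ENNReal.ofReal_eq_zero, not_le]
  exact hR0.trans hx'

theorem isWeakSolution_dirac_zero {K : ℝ → ℝ → ℝ} (hK : K 0 0 = 0) (b : ℝ) :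
    IsWeakSolution K b (Measure.dirac 0) := by
  intro θ _
  have h0 : coagIntegrand K θ 0 0 = 0 := by simp [coagIntegrand, hK]
  refine ⟨?_, ?_⟩
  · rw [Measure.dirac_prod_dirac]
    refine Integrable.integrableOn ?_
    refine integrable_dirac (by simp [h0])
  · have hr : (Measure.dirac (0 : ℝ)).restrict (Ici 0) = Measure.dirac 0 :=
      Measure.restrict_eq_self_of_ae_mem (by simp [ae_dirac_eq])
    rw [hr]
    simp [h0]

theorem theorem1p2 (K : ℝ → ℝ → ℝ)
    (hK_cont : ContinuousOn (fun p : ℝ × ℝ => K p.1 p.2) (Ici 0 ×ˢ Ici 0))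
    (hK_symm : ∀ x y : ℝ, 0 ≤ x → 0 ≤ y → K x y = K y x)
    (hK_nonneg : ∀ x y : ℝ, 0 ≤ x → 0 ≤ y → 0 ≤ K x y)
    (hK_hom : ∀ a x y : ℝ, 0 < a → 0 < x → 0 < y → K (a * x) (a * y) = a * K x y)
    (α β₀ k₀ : ℝ) (hα₀ : 0 < α) (hα₁ : α < 1) (hβ₀ : 0 < β₀) (hk₀ : 0 < k₀)
    (hK_lim : Tendsto (fun ξ : ℝ => (K 1 ξ - 1) / ξ ^ α) (𝓝[>] 0) (𝓝 β₀))
    (hK_pos : ∀ ξ : ℝ, 0 ≤ ξ → k₀ ≤ K 1 ξ) :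
    (∃ bStar : ℝ, 1 < bStar ∧ ∀ b : ℝ, 1 < b → b < bStar → ∀ g : Measure ℝ,
      (IsRadonOnHalfLine g ∧ g univ = 1 ∧ IsWeakSolution K b g) ↔ g = Measure.dirac 0) ∧
    (∃ ρStar : ℝ, 0 < ρStar ∧ ∀ ρ : ℝ, ρStar < ρ →
      ¬ ∃ g : Measure ℝ, IsRadonOnHalfLine g ∧ g univ = 1 ∧
        IsWeakSolution K ((1 + ρ) / ρ) g ∧ g ≠ Measure.dirac 0) := by
  have hK : ∀ y z : ℝ, 0 ≤ y → 0 < z → K y z = z * K 1 (y / z) := fun y z hy hz =>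
    kernel_eq_mul_kernel_one hK_cont hK_symm hK_hom hy hz
  -- The integrand for `δ₀` lives at `(0, 0)`, where homogeneity is not assumed; the value comes
  -- from continuity.
  have hK00 : K 0 0 = 0 := by
    have h1 : Tendsto (fun z : ℝ => K 0 z) (𝓝[>] 0) (𝓝 (K 0 0)) := by
      have hcont : ContinuousOn (fun z : ℝ => K 0 z) (Ici 0) :=
        hK_cont.comp (f := fun z : ℝ => ((0 : ℝ), z)) (by fun_prop)
          (fun t ht => ⟨mem_Ici.2 le_rfl, ht⟩)
      exact (hcont 0 (mem_Ici.2 le_rfl)).mono_left (nhdsWithin_mono _ Ioi_subset_Ici_self)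
    have h2 : Tendsto (fun z : ℝ => z * K 1 0) (𝓝[>] 0) (𝓝 0) := by
      have : Continuous fun z : ℝ => z * K 1 0 := by fun_prop
      simpa using (this.tendsto 0).mono_left (nhdsWithin_le_nhds (s := Ioi 0))
    refine tendsto_nhds_unique (h1.congr' ?_) h2
    filter_upwards [self_mem_nhdsWithin] with z hz
    rw [hK 0 z le_rfl hz, zero_div]
  obtain ⟨ε, hε0, hε1, hKε⟩ := exists_one_add_rpow_le hβ₀ hK_lim
  obtain ⟨bStar, hb, huniq⟩ := exists_eq_dirac_of_isWeakSolution hK_nonneg hK_symm hK hα₀ hα₁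
    (half_pos hβ₀) hk₀ hK_pos hε0 hε1 hKε
  refine ⟨⟨bStar, hb, fun b hb1 hb2 g => ⟨fun h => huniq b hb1 hb2 g h.1 h.2.1 h.2.2, ?_⟩⟩,
    ⟨1 / (bStar - 1), one_div_pos.2 (by linarith), ?_⟩⟩
  · rintro rfl
    exact ⟨⟨inferInstance, by simp⟩, measure_univ, isWeakSolution_dirac_zero hK00 b⟩
  · rintro ρ hρ ⟨g, h1, h2, h3, h4⟩
    have hρ0 : 0 < ρ := (one_div_pos.2 (by linarith)).trans hρ
    rw [div_lt_iff₀ (by linarith)] at hρ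
    refine h4 (huniq _ ?_ ?_ g h1 h2 h3)
    · rw [lt_div_iff₀ hρ0]; linarith
    · rw [div_lt_iff₀ hρ0]; linarith
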